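/- Let $U$ be a set of $n\ge 1$ items with weights $w:U\to[0,\infty)$ and total weight $W=\sum_{a\in U}w(a)>0$. In the hybrid setting, an algorithm accesses $(U,w)$ only through independent samples: at each step it may choose, adaptively and using internal randomness, to take either a proportional sample (item $a$ with probability $w(a)/W$) or a uniform sample (each item with probability $1/n$). It learns the weight of every sampled item and, for any two samples, whether they are the same item, and nothing else about $(U,w)$. It may decide at run-time when to stop and return an estimate $\hat W$. The numbers $n$ and $\varepsilon$ are known to the algorithm. Theorem. For every $\varepsilon_0<1$ there is a constant $c>0$, depending only on $\varepsilon_0$, such that the following holds for all integers $n\ge 1$ and all $0<\varepsilon\le\varepsilon_0$. If an algorithm in the hybrid setting returns, for every instance $(U,w)$ with $|U|=n$ and $W>0$, with probability at least $2/3$ an estimate $\hat W$ with $(1-\varepsilon)W\le\hat W\le(1+\varepsilon)W$, then there is an instance $(U,w)$ with $|U|=n$ and $W>0$ on which the expected total number of (proportional and uniform) samples that it takes is at least $$c\cdot\min\left(\frac{n^{1/3}}{\varepsilon^{4/3}},\,n\right).$$ In particular, its worst-case number of samples is at least this large. -/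

import Mathlib

open MeasureTheory
open scoped ENNReal NNReal

/-- An instance of the sum estimation problem with exactly `n` items: a weight function
`w : U → [0, ∞)` on a set `U` of `n` items (here `U = Fin n`; algorithms never see the names of the
items). The total weight is positive, so that proportional sampling makes sense. -/
structure SumInstance (n : ℕ) where
  w : Fin n → ℝ≥0
  sum_pos : 0 < ∑ a, w a

namespace SumInstance

variable {n : ℕ}

/-- The total weight `W`. -/
def total (I : SumInstance n) : ℝ := ∑ a, (I.w a : ℝ)

theorem nonempty_items (I : SumInstance n) : Nonempty (Fin n) := by
  by_contra h
  rw [not_nonempty_iff] at h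
  have h0 := I.sum_pos
  simp at h0

theorem tsum_ne_zero (I : SumInstance n) : ∑' a, (I.w a : ℝ≥0∞) ≠ 0 := by
  rw [tsum_fintype]
  exact_mod_cast I.sum_pos.ne'

theorem tsum_ne_top (I : SumInstance n) : ∑' a, (I.w a : ℝ≥0∞) ≠ ∞ := by
  rw [tsum_fintype]
  exact_mod_cast ENNReal.coe_ne_top (r := ∑ a, I.w a)

/-- The law of a proportional sample: item `a` has probability `w a / W`. -/
noncomputable def proportional (I : SumInstance n) : PMF (Fin n) :=
  PMF.normalize (fun a => (I.w a : ℝ≥0∞)) I.tsum_ne_zero I.tsum_ne_top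

/-- The law of a uniform sample: every item has probability `1 / n`. -/
noncomputable def uniform (I : SumInstance n) : PMF (Fin n) :=
  haveI := I.nonempty_items
  PMF.uniformOfFintype (Fin n)

/-- An infinite supply of independent samples: for every `t : ℕ`, the first component of `x t` is a
proportional sample, its second component is a uniform sample, and all of them are independent. -/
noncomputable def supply (I : SumInstance n) : Measure (ℕ → Fin n × Fin n) :=
  Measure.infinitePi fun _ => I.proportional.toMeasure.prod I.uniform.toMeasure

/-- All that can be learnt about a sequence `s` of `t` sampled items: the weight of each of them,
and, for any two of them, whether they are the same item. -/
def view (I : SumInstance n) {t : ℕ} (s : Fin t → Fin n) : (Fin t → ℝ) × (Fin t → Fin t → Bool) :=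
  (fun i => (I.w (s i) : ℝ), fun i j => decide (s i = s j))

end SumInstance

/-- The two kinds of samples of the hybrid setting. -/
inductive SampleKind
  | proportional
  | uniform

instance : MeasurableSpace SampleKind := ⊤

/-- An adaptive randomized algorithm in the hybrid setting, with internal randomness in `Ω`. After
`t` samples it decides, from its randomness and from the weights and the equality pattern of the
`t` sampled items, either to take one more sample of a kind of its choice (`Sum.inl`), or to stop
and to return an estimate (`Sum.inr`). -/
structure HybridAlgorithm (Ω : Type*) [MeasurableSpace Ω] where
  step : (t : ℕ) → Ω × (Fin t → ℝ) × (Fin t → Fin t → Bool) → SampleKind ⊕ ℝ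
  measurable_step : ∀ t, Measurable (step t)

namespace HybridAlgorithm

variable {Ω : Type*} [MeasurableSpace Ω] (A : HybridAlgorithm Ω) {n : ℕ} (I : SumInstance n)

/-- The first `t` items sampled when the algorithm runs on `I` with internal randomness `r` and
supply of samples `x`: the sample number `t` is one of the two components of `x t`. (The value after
the algorithm has stopped is irrelevant.) -/
def sampled (r : Ω) (x : ℕ → Fin n × Fin n) : (t : ℕ) → Fin t → Fin n
  | 0 => Fin.elim0
  | t + 1 =>
    Fin.snoc (α := fun _ => Fin n) (sampled r x t)
      (match A.step t (r, I.view (sampled r x t)) with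
        | Sum.inl SampleKind.proportional => (x t).1
        | Sum.inl SampleKind.uniform => (x t).2
        | Sum.inr _ => (x t).2)

/-- What the algorithm does after `t` samples. -/
def action (r : Ω) (x : ℕ → Fin n × Fin n) (t : ℕ) : SampleKind ⊕ ℝ :=
  A.step t (r, I.view (A.sampled I r x t))

/-- The run takes exactly `t` samples, then stops and returns `y`. -/
def Returns (r : Ω) (x : ℕ → Fin n × Fin n) (t : ℕ) (y : ℝ) : Prop :=
  (∀ s < t, (A.action I r x s).isLeft) ∧ A.action I r x t = Sum.inr y

/-- The number of samples that the run takes in total: the first time at which the algorithm stops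
(`∞` if it never stops). -/
noncomputable def numSamples (r : Ω) (x : ℕ → Fin n × Fin n) : ℝ≥0∞ :=
  ⨅ (t : ℕ) (_ : (A.action I r x t).isRight), (t : ℝ≥0∞)

/-- The expected number of samples on the instance `I`, when the internal randomness has law `P`. -/
noncomputable def expectedSamples (P : Measure Ω) : ℝ≥0∞ :=
  ∫⁻ z, A.numSamples I z.1 z.2 ∂(P.prod I.supply)

/-- The probability that, on the instance `I`, the algorithm stops and returns a
`(1 ± ε)`-approximation of the total weight. -/
noncomputable def successProb (P : Measure Ω) (ε : ℝ) : ℝ≥0∞ :=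
  (P.prod I.supply) {z | ∃ (t : ℕ) (y : ℝ), A.Returns I z.1 z.2 t y ∧
    (1 - ε) * I.total ≤ y ∧ y ≤ (1 + ε) * I.total}

end HybridAlgorithm

/-!
The lower bound comes from two instances with weights in `{0, 1}`, one with `s` and one with
`s + d` unit items, whose totals no estimate can serve at once when `d` is a large multiple of
`ε s`. The observations of an algorithm are compared through the second moment of their likelihood
ratio. Given equal observations so far, only the numbers of unseen items of each weight differ, so
that the `(t + 1)`-st sample multiplies the second moment by at most `1 + O(t d² / s³)` if it is
proportional (a difference shows only through collisions) and by at most `1 + O(d² / (s n))` if it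
is uniform. After `m` samples the second moment is still close to `1` as long as
`m² d² / s³ + m d² / (s n)` is small. With `L = n^(1/3) / ε^(4/3)`, the choice `s ≈ L² ε²` balances
the two terms, and both are small for `m` up to a small multiple of `L`. A second moment close to
`1` makes the two laws close in total variation, so an algorithm that is correct on both instances
must take more than `m` samples with constant probability on one of them.

This requires `s` to be at most a small multiple of `n`, that is `L ε²` to be large. For smaller
`ε`, the same argument at the accuracy `ε' ≈ n^(-1/2)` gives a bound of order `n`, which is then
the order of the minimum. For bounded `n`, one only needs that an algorithm cannot answer without
samples.
-/

theorem indepFun_eval_of_dependsOn {ι β : Type*} {α : ι → Type*} [∀ i, MeasurableSpace (α i)]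
    [MeasurableSpace β] (μ : ∀ i, Measure (α i)) [∀ i, IsProbabilityMeasure (μ i)]
    {f : (∀ i, α i) → β} (hf : Measurable f) {s : Finset ι} (hfs : DependsOn f s) {t : ι}
    (ht : t ∉ s) :
    ProbabilityTheory.IndepFun f (fun x => x t) (Measure.infinitePi μ) := by
  classical
  obtain ⟨x₀⟩ : Nonempty (∀ i, α i) := ⟨fun i => (nonempty_of_isProbabilityMeasure (μ i)).some⟩
  have hrestrict : f = (f ∘ Function.updateFinset x₀ s) ∘ s.restrict :=
    funext fun x => hfs fun i hi => by simp [Function.updateFinset, Finset.mem_coe.1 hi]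
  have hindep := (ProbabilityTheory.iIndepFun_infinitePi (P := μ) (X := fun _ x => x)
    fun _ => measurable_id).indepFun_finset s {t} (Finset.disjoint_singleton_right.2 ht)
    fun i => measurable_pi_apply i
  rw [hrestrict]
  exact hindep.comp (hf.comp measurable_updateFinset)
    (measurable_pi_apply (⟨t, Finset.mem_singleton_self t⟩ : ({t} : Finset ι)))

theorem integral_const_add_const_mul_indicator {α : Type*} [MeasurableSpace α] {μ : Measure α}
    [IsProbabilityMeasure μ] {D : Set α} (hD : MeasurableSet D) (c d : ℝ) :
    ∫ a, (c + d * D.indicator 1 a) ∂μ = c + d * μ.real D := by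
  have hint : Integrable (D.indicator (1 : α → ℝ)) μ := (integrable_const 1).indicator hD
  rw [integral_add (integrable_const c) (hint.const_mul d), integral_const_mul,
    integral_indicator_one hD, integral_const, probReal_univ, one_smul]

/-- The law `ν` is hard to tell from the law `μ` when `a` and `b` are observed to be the same
whenever `R a b`: the likelihood ratio of the observation has second moment at most `K`, that is
`1 + χ²(ν ‖ μ) ≤ K` on the common observable. Testing against functions `G` and `H` that need not
be functions of the observation spares us the likelihood ratio itself. The integrals are meaningful
when all functions are integrable, for instance for finite measures on finite types. -/
def SecondMomentLE {α β : Type*} [MeasurableSpace α] [MeasurableSpace β] (R : α → β → Prop)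
    (μ : Measure α) (ν : Measure β) (K : ℝ) : Prop :=
  ∀ (G : α → ℝ) (H : β → ℝ), (∀ a, 0 ≤ G a) → (∀ a b, R a b → H b ^ 2 ≤ G a) →
    (∫ b, H b ∂ν) ^ 2 ≤ K * ∫ a, G a ∂μ

namespace SecondMomentLE

variable {α β : Type*} [MeasurableSpace α] [MeasurableSpace β] {R : α → β → Prop}
  {μ : Measure α} {ν : Measure β} {K : ℝ}

theorem mono {K' : ℝ} (h : SecondMomentLE R μ ν K) (hK : K ≤ K') : SecondMomentLE R μ ν K' :=
  fun G H hG hGH => (h G H hG hGH).trans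
    (mul_le_mul_of_nonneg_right hK (integral_nonneg hG))

variable [IsProbabilityMeasure μ] [IsProbabilityMeasure ν]

theorem one_le (h : SecondMomentLE R μ ν K) : 1 ≤ K := by
  simpa using h (fun _ => 1) (fun _ => 1) (fun _ => zero_le_one) fun _ _ _ => by simp

theorem four_mul_sq_measureReal_sub_le (h : SecondMomentLE R μ ν K) {D : Set α} {D' : Set β}
    (hD : MeasurableSet D) (hD' : MeasurableSet D') (hR : ∀ a b, R a b → (a ∈ D ↔ b ∈ D')) :
    4 * (ν.real D' - μ.real D) ^ 2 ≤ K - 1 := by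
  set q := ν.real D'
  set p := μ.real D
  -- The optimal test function is `1 + l * (1_D - p)`, whose variance is at most `l ^ 2 / 4`.
  set l := 4 * (q - p) with hl
  set u := 1 - l * p with hu
  have hsq : ∀ {γ : Type _} (E : Set γ) (x : γ),
      (u + l * E.indicator 1 x) ^ 2 = u ^ 2 + (2 * u * l + l ^ 2) * E.indicator 1 x := by
    intro γ E x
    by_cases hx : x ∈ E
    · simp [hx]; ring
    · simp [hx]
  have htest := h (fun a => u ^ 2 + (2 * u * l + l ^ 2) * D.indicator 1 a)
    (fun b => u + l * D'.indicator 1 b) (fun a => hsq D a ▸ sq_nonneg _) fun a b hab => by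
      have hind : D'.indicator (1 : β → ℝ) b = D.indicator 1 a := by
        by_cases ha : a ∈ D <;> simp [ha, ← hR a b hab]
      rw [← hsq, hind]
  rw [integral_const_add_const_mul_indicator hD,
    integral_const_add_const_mul_indicator hD'] at htest
  have hmean : u + l * q = 1 + 4 * (q - p) ^ 2 := by rw [hu, hl]; ring
  have hvar : u ^ 2 + (2 * u * l + l ^ 2) * p ≤ 1 + 4 * (q - p) ^ 2 := by
    have : u ^ 2 + (2 * u * l + l ^ 2) * p = 1 + 4 * (q - p) ^ 2 - l ^ 2 * (p - 1 / 2) ^ 2 := by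
      rw [hu, hl]; ring
    rw [this]
    linarith [mul_nonneg (sq_nonneg l) (sq_nonneg (p - 1 / 2))]
  have hpos : 0 < 1 + 4 * (q - p) ^ 2 := by positivity
  have hle : (1 + 4 * (q - p) ^ 2) * (1 + 4 * (q - p) ^ 2) ≤ K * (1 + 4 * (q - p) ^ 2) := by
    rw [← sq, ← hmean]
    refine htest.trans ?_
    rw [hmean]
    exact mul_le_mul_of_nonneg_left hvar (zero_le_one.trans h.one_le)
  linarith [le_of_mul_le_mul_right hle hpos]

end SecondMomentLE

instance : DiscreteMeasurableSpace SampleKind := ⟨fun _ => trivial⟩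

namespace SampleKind

instance : Finite SampleKind :=
  .of_surjective (fun b : Bool => cond b proportional uniform) fun
    | proportional => ⟨true, rfl⟩
    | uniform => ⟨false, rfl⟩

/-- The kind of sample requested by a step of an algorithm; by convention, the uniform kind if the
step stops, as in `HybridAlgorithm.sampled`. -/
def ofStep : SampleKind ⊕ ℝ → SampleKind :=
  Sum.elim id fun _ => uniform

/-- The component of a pair (proportional sample, uniform sample) that has the given kind. -/
def select {α : Type*} : SampleKind → α × α → α
  | proportional => Prod.fst
  | uniform => Prod.snd

theorem measurable_ofStep : Measurable ofStep :=
  measurable_id.sumElim measurable_const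

end SampleKind

namespace SumInstance

variable {n : ℕ} (I : SumInstance n)

instance : IsProbabilityMeasure I.supply := by
  unfold supply; infer_instance

/-- The law of a single sample of the given kind. -/
noncomputable def sampleLaw : SampleKind → Measure (Fin n)
  | .proportional => I.proportional.toMeasure
  | .uniform => I.uniform.toMeasure

instance (k : SampleKind) : IsProbabilityMeasure (I.sampleLaw k) := by
  cases k <;> unfold sampleLaw <;> infer_instance

theorem integral_select (k : SampleKind) (f : Fin n → ℝ) :
    ∫ z, f (k.select z) ∂(I.proportional.toMeasure.prod I.uniform.toMeasure) =
      ∫ a, f a ∂I.sampleLaw k := by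
  cases k
  · exact (integral_fun_fst f).trans (by simp [sampleLaw])
  · exact (integral_fun_snd f).trans (by simp [sampleLaw])

theorem integral_sampleLaw_uniform (f : Fin n → ℝ) :
    ∫ a, f a ∂I.sampleLaw .uniform = (∑ a, f a) / n := by
  simp [sampleLaw, PMF.integral_eq_sum, uniform, Finset.mul_sum, div_eq_inv_mul]

theorem integral_sampleLaw_proportional (f : Fin n → ℝ) :
    ∫ a, f a ∂I.sampleLaw .proportional = (∑ a, I.w a * f a) / I.total := by
  have hmass (a : Fin n) : (I.proportional a).toReal = I.w a / I.total := by
    rw [proportional, PMF.normalize_apply, tsum_fintype, ENNReal.toReal_mul, ENNReal.toReal_inv,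
      ENNReal.toReal_sum fun _ _ => ENNReal.coe_ne_top]
    rfl
  simp only [sampleLaw, PMF.integral_eq_sum, hmass, smul_eq_mul, Finset.sum_div, div_mul_eq_mul_div]

/-- Sequences of items of two instances that look the same to an algorithm. -/
def SameView (I I' : SumInstance n) {t : ℕ} (X X' : Fin t → Fin n) : Prop :=
  I.view X = I'.view X'

theorem sameView_iff {I I' : SumInstance n} {t : ℕ} {X X' : Fin t → Fin n} :
    SameView I I' X X' ↔
      (∀ i, I.w (X i) = I'.w (X' i)) ∧ ∀ i j, X i = X j ↔ X' i = X' j := by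
  simp [SameView, view, funext_iff]

/-- Items of two instances that look the same to an algorithm which has already sampled the
sequences `X` and `X'`, respectively. -/
def SameExtension (I I' : SumInstance n) {t : ℕ} (X X' : Fin t → Fin n) (a a' : Fin n) : Prop :=
  SameView I I' (Fin.snoc (α := fun _ => Fin n) X a) (Fin.snoc (α := fun _ => Fin n) X' a')

variable {I} {I' : SumInstance n} {t : ℕ} {X X' : Fin t → Fin n}

theorem SameView.take (h : SameView I I' X X') {s : ℕ} (hs : s ≤ t) :
    SameView I I' (Fin.take s hs X) (Fin.take s hs X') :=
  sameView_iff.2 ⟨fun i => (sameView_iff.1 h).1 (Fin.castLE hs i),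
    fun i j => (sameView_iff.1 h).2 (Fin.castLE hs i) (Fin.castLE hs j)⟩

theorem sameExtension_iff (hX : SameView I I' X X') {a a' : Fin n} :
    SameExtension I I' X X' a a' ↔ I.w a = I'.w a' ∧ ∀ i, X i = a ↔ X' i = a' := by
  obtain ⟨hweight, hpattern⟩ := sameView_iff.1 hX
  simp [SameExtension, sameView_iff, Fin.forall_fin_succ', hweight, hpattern, eq_comm (a := a),
    eq_comm (a := a')]

end SumInstance

namespace HybridAlgorithm

open SumInstance

variable {Ω : Type*} [MeasurableSpace Ω] (A : HybridAlgorithm Ω) {n : ℕ} (I : SumInstance n)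

/-- The kind of the sample taken after the items `X` have been sampled. -/
def nextKind (r : Ω) {t : ℕ} (X : Fin t → Fin n) : SampleKind :=
  SampleKind.ofStep (A.step t (r, I.view X))

theorem sampled_succ (r : Ω) (x : ℕ → Fin n × Fin n) (t : ℕ) :
    A.sampled I r x (t + 1) = Fin.snoc (α := fun _ => Fin n) (A.sampled I r x t)
      ((A.nextKind I r (A.sampled I r x t)).select (x t)) := by
  rw [sampled, nextKind]
  congr 1
  rcases A.step t (r, I.view (A.sampled I r x t)) with (_ | _) | _ <;> rfl

theorem take_sampled (r : Ω) (x : ℕ → Fin n × Fin n) {s t : ℕ} (h : s ≤ t) :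
    Fin.take s h (A.sampled I r x t) = A.sampled I r x s := by
  induction t, h using Nat.le_induction with
  | base => rfl
  | succ t h ih =>
    rw [← ih]
    funext i
    rw [sampled_succ]
    exact Fin.snoc_castSucc (α := fun _ => Fin n) _ _ (Fin.castLE h i)

theorem dependsOn_sampled (r : Ω) (t : ℕ) :
    DependsOn (fun x => A.sampled I r x t) (Finset.range t) := by
  induction t with
  | zero => exact fun _ _ _ => rfl
  | succ t ih =>
    intro x y hxy
    have hpast : A.sampled I r x t = A.sampled I r y t :=
      ih fun s hs => hxy s (Finset.range_subset_range.2 t.le_succ hs)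
    simp only [sampled_succ, hpast, hxy t (Finset.self_mem_range_succ t)]

theorem measurable_sampled (t : ℕ) :
    Measurable fun z : Ω × (ℕ → Fin n × Fin n) => A.sampled I z.1 z.2 t := by
  induction t with
  | zero => exact measurable_const
  | succ t ih =>
    have hkind : Measurable fun z : Ω × (ℕ → Fin n × Fin n) =>
        A.nextKind I z.1 (A.sampled I z.1 z.2 t) :=
      SampleKind.measurable_ofStep.comp ((A.measurable_step t).comp (measurable_fst.prodMk
        ((Measurable.of_discrete (f := I.view)).comp ih)))
    have hsnoc : Measurable fun q : (Fin t → Fin n) × SampleKind × (Fin n × Fin n) =>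
        (Fin.snoc (α := fun _ => Fin n) q.1 (q.2.1.select q.2.2) : Fin (t + 1) → Fin n) :=
      .of_discrete
    simp only [sampled_succ]
    exact hsnoc.comp (ih.prodMk (hkind.prodMk ((measurable_pi_apply t).comp measurable_snd)))

theorem measurable_sampled_right (r : Ω) (t : ℕ) : Measurable fun x => A.sampled I r x t :=
  (A.measurable_sampled I t).comp measurable_prodMk_left

/-- The law of the first `t` sampled items, for fixed internal randomness. -/
noncomputable def law (r : Ω) (t : ℕ) : Measure (Fin t → Fin n) :=
  I.supply.map fun x => A.sampled I r x t

instance (r : Ω) (t : ℕ) : IsProbabilityMeasure (A.law I r t) :=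
  Measure.isProbabilityMeasure_map (A.measurable_sampled_right I r t).aemeasurable

theorem map_sampled_prodMk_eval (r : Ω) (t : ℕ) :
    I.supply.map (fun x => (A.sampled I r x t, x t)) =
      (A.law I r t).prod (I.proportional.toMeasure.prod I.uniform.toMeasure) := by
  have hindep : ProbabilityTheory.IndepFun (fun x => A.sampled I r x t) (fun x => x t) I.supply :=
    indepFun_eval_of_dependsOn _ (A.measurable_sampled_right I r t) (A.dependsOn_sampled I r t)
      Finset.notMem_range_self
  have heval : I.supply.map (fun x => x t) = I.proportional.toMeasure.prod I.uniform.toMeasure :=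
    (measurePreserving_eval_infinitePi _ t).map_eq
  rw [(ProbabilityTheory.indepFun_iff_map_prod_eq_prod_map_map
    (A.measurable_sampled_right I r t).aemeasurable (measurable_pi_apply t).aemeasurable).1 hindep,
    heval, law]

theorem integral_law_succ (r : Ω) (t : ℕ) (h : (Fin (t + 1) → Fin n) → ℝ) :
    ∫ X, h X ∂A.law I r (t + 1) =
      ∫ X, ∫ a, h (Fin.snoc (α := fun _ => Fin n) X a) ∂I.sampleLaw (A.nextKind I r X)
        ∂A.law I r t := by
  calc ∫ X, h X ∂A.law I r (t + 1)
    _ = ∫ x, h (A.sampled I r x (t + 1)) ∂I.supply :=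
        integral_map (A.measurable_sampled_right I r (t + 1)).aemeasurable
          Measurable.of_discrete.aestronglyMeasurable
    _ = ∫ z, h (Fin.snoc (α := fun _ => Fin n) z.1 ((A.nextKind I r z.1).select z.2))
          ∂I.supply.map fun x => (A.sampled I r x t, x t) := by
        simp only [sampled_succ]
        exact (integral_map ((A.measurable_sampled_right I r t).prodMk
          (measurable_pi_apply t)).aemeasurable
          (Measurable.of_discrete (f := fun z : (Fin t → Fin n) × (Fin n × Fin n) =>
            h (Fin.snoc (α := fun _ => Fin n) z.1
              ((A.nextKind I r z.1).select z.2)))).aestronglyMeasurable).symm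
    _ = _ := by
        rw [map_sampled_prodMk_eval, integral_prod _ .of_finite]
        exact integral_congr_ae (.of_forall fun X =>
          I.integral_select (A.nextKind I r X) fun a => h (Fin.snoc X a))

variable {I} {I' : SumInstance n}

theorem nextKind_congr (r : Ω) {t : ℕ} {X X' : Fin t → Fin n} (h : SameView I I' X X') :
    A.nextKind I r X = A.nextKind I' r X' := by
  rw [nextKind, nextKind, h]

theorem secondMomentLE_law_zero (r : Ω) :
    SecondMomentLE (SameView I I') (A.law I r 0) (A.law I' r 0) 1 := by
  intro G H _ hGH
  simpa [integral_unique] using hGH default default (Subsingleton.elim _ _)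

theorem secondMomentLE_law_succ (r : Ω) {t : ℕ} {K L : ℝ} (hL : 0 ≤ L)
    (hlaw : SecondMomentLE (SameView I I') (A.law I r t) (A.law I' r t) K)
    (hstep : ∀ X X' : Fin t → Fin n, SameView I I' X X' → ∀ k,
      SecondMomentLE (SameExtension I I' X X') (I.sampleLaw k) (I'.sampleLaw k) L) :
    SecondMomentLE (SameView I I') (A.law I r (t + 1)) (A.law I' r (t + 1)) (K * L) := by
  intro G H hG hGH
  rw [integral_law_succ, integral_law_succ, mul_assoc, ← integral_const_mul]
  refine hlaw _ _ (fun X => mul_nonneg hL (integral_nonneg fun a => hG _)) fun X X' hX => ?_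
  rw [A.nextKind_congr r hX]
  exact hstep X X' hX _ _ _ (fun a => hG _) fun a a' haa' => hGH _ _ haa'

theorem secondMomentLE_law (r : Ω) {m : ℕ} {L : ℝ} (hL : 0 ≤ L)
    (hstep : ∀ t < m, ∀ X X' : Fin t → Fin n, SameView I I' X X' → ∀ k,
      SecondMomentLE (SameExtension I I' X X') (I.sampleLaw k) (I'.sampleLaw k) L) :
    SecondMomentLE (SameView I I') (A.law I r m) (A.law I' r m) (L ^ m) := by
  induction m with
  | zero => simpa using A.secondMomentLE_law_zero r
  | succ m ih =>
    rw [pow_succ]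
    exact A.secondMomentLE_law_succ r hL (ih fun t ht => hstep t (ht.trans m.lt_succ_self))
      (hstep m m.lt_succ_self)

section ReturnEvents

variable (I I' : SumInstance n)

/-- The runs that take at least `m` samples. -/
def takesAtLeast (m : ℕ) : Set (Ω × (ℕ → Fin n × Fin n)) :=
  {z | ∀ s < m, (A.action I z.1 z.2 s).isLeft}

/-- The runs that return an element of `J` after at most `m` samples. -/
def returnsWithin (m : ℕ) (J : Set ℝ) : Set (Ω × (ℕ → Fin n × Fin n)) :=
  {z | ∃ t ≤ m, ∃ y ∈ J, A.Returns I z.1 z.2 t y}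

theorem measurable_action (t : ℕ) :
    Measurable fun z : Ω × (ℕ → Fin n × Fin n) => A.action I z.1 z.2 t :=
  (A.measurable_step t).comp (measurable_fst.prodMk
    ((Measurable.of_discrete (f := I.view)).comp (A.measurable_sampled I t)))

theorem measurableSet_takesAtLeast (m : ℕ) : MeasurableSet (A.takesAtLeast I m) := by
  have hleft : MeasurableSet {y : SampleKind ⊕ ℝ | y.isLeft} := by
    convert (measurableSet_range_inl : MeasurableSet (Set.range (Sum.inl : _ → SampleKind ⊕ ℝ)))
    exact Set.ext fun y => by cases y <;> simp
  rw [takesAtLeast, Set.ofPred_forall]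
  refine .iInter fun s => ?_
  rw [Set.ofPred_forall]
  exact .iInter fun _ => A.measurable_action I s hleft

theorem measurableSet_returnsWithin (m : ℕ) {J : Set ℝ} (hJ : MeasurableSet J) :
    MeasurableSet (A.returnsWithin I m J) := by
  have hunion : A.returnsWithin I m J = ⋃ t ∈ Set.Iic m, A.takesAtLeast I t ∩
      (fun z : Ω × (ℕ → Fin n × Fin n) => A.action I z.1 z.2 t) ⁻¹' (Sum.inr '' J) := by
    ext z
    simp only [returnsWithin, takesAtLeast, Returns, Set.mem_ofPred_eq, Set.mem_iUnion,
      Set.mem_inter_iff, Set.mem_preimage, Set.mem_image, Set.mem_Iic, exists_prop]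
    grind
  rw [hunion]
  exact .biUnion (Set.to_countable _) fun t _ =>
    (A.measurableSet_takesAtLeast I t).inter (A.measurable_action I t hJ.inr_image)

variable {A I} in
theorem Returns.unique {r : Ω} {x : ℕ → Fin n × Fin n} {t t' : ℕ} {y y' : ℝ}
    (h : A.Returns I r x t y) (h' : A.Returns I r x t' y') : t = t' ∧ y = y' := by
  have hle {u u' : ℕ} {v v' : ℝ} (hu : A.Returns I r x u v) (hu' : A.Returns I r x u' v') :
      u ≤ u' := by
    by_contra! hlt
    simpa [hu'.2] using hu.1 u' hlt
  obtain rfl : t = t' := (hle h h').antisymm (hle h' h)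
  exact ⟨rfl, Sum.inr_injective (h.2.symm.trans h'.2)⟩

theorem disjoint_returnsWithin (m : ℕ) {J J' : Set ℝ} (h : Disjoint J J') :
    Disjoint (A.returnsWithin I m J) (A.returnsWithin I m J') := by
  rw [Set.disjoint_left]
  rintro z ⟨t, -, y, hy, hz⟩ ⟨t', -, y', hy', hz'⟩
  obtain ⟨-, rfl⟩ := hz.unique hz'
  exact Set.disjoint_left.1 h hy hy'

theorem mul_measure_takesAtLeast_le (P : Measure Ω) (m : ℕ) :
    m * (P.prod I.supply) (A.takesAtLeast I m) ≤ A.expectedSamples I P := by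
  have hnum : ∀ z ∈ A.takesAtLeast I m, (m : ℝ≥0∞) ≤ A.numSamples I z.1 z.2 := by
    refine fun z hz => le_iInf₂ fun t ht => ?_
    by_contra! hlt
    exact Sum.not_isLeft.2 ht (hz t (mod_cast hlt))
  calc m * (P.prod I.supply) (A.takesAtLeast I m)
    _ = ∫⁻ _ in A.takesAtLeast I m, (m : ℝ≥0∞) ∂P.prod I.supply := (setLIntegral_const _ _).symm
    _ ≤ ∫⁻ z in A.takesAtLeast I m, A.numSamples I z.1 z.2 ∂P.prod I.supply :=
        setLIntegral_mono' (A.measurableSet_takesAtLeast I m) hnum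
    _ ≤ A.expectedSamples I P := setLIntegral_le_lintegral _ _

theorem successProb_le_measure_returnsWithin_add {P : Measure Ω} {ε : ℝ} {m : ℕ} {δ : ℝ≥0∞}
    (h : A.expectedSamples I P ≤ ((m + 1 : ℕ) : ℝ≥0∞) * δ) :
    A.successProb I P ε ≤ (P.prod I.supply)
      (A.returnsWithin I m (Set.Icc ((1 - ε) * I.total) ((1 + ε) * I.total))) + δ := by
  have hlong : (P.prod I.supply) (A.takesAtLeast I (m + 1)) ≤ δ :=
    (ENNReal.mul_le_mul_iff_right (by simp) (ENNReal.natCast_ne_top _)).1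
      ((A.mul_measure_takesAtLeast_le I P (m + 1)).trans h)
  refine ((measure_mono ?_).trans (measure_union_le _ _)).trans (add_le_add_right hlong _)
  rintro z ⟨t, y, hret, hlow, hupp⟩
  rcases le_or_gt t m with ht | ht
  · exact .inl ⟨t, ht, y, ⟨hlow, hupp⟩, hret⟩
  · exact .inr fun s hs => hret.1 s (by omega)

theorem successProb_mono (P : Measure Ω) {ε ε' : ℝ} (h : ε ≤ ε') :
    A.successProb I P ε ≤ A.successProb I P ε' := by
  have htotal : 0 ≤ I.total := Finset.sum_nonneg fun _ _ => NNReal.coe_nonneg _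
  refine measure_mono ?_
  rintro z ⟨t, y, hret, hlow, hupp⟩
  exact ⟨t, y, hret, le_trans (by gcongr) hlow, hupp.trans (by gcongr)⟩

/-- The first items of the sequence `X` make the algorithm stop and return an element of `J`. -/
def HasReturned (r : Ω) (J : Set ℝ) {m : ℕ} (X : Fin m → Fin n) : Prop :=
  ∃ (t : ℕ) (ht : t ≤ m), ∃ y ∈ J,
    (∀ (s : ℕ) (hs : s < t), (A.step s (r, I.view (Fin.take s (hs.le.trans ht) X))).isLeft) ∧
      A.step t (r, I.view (Fin.take t ht X)) = Sum.inr y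

theorem mem_returnsWithin_iff (r : Ω) (x : ℕ → Fin n × Fin n) (m : ℕ) (J : Set ℝ) :
    (r, x) ∈ A.returnsWithin I m J ↔ A.HasReturned I r J (A.sampled I r x m) := by
  simp only [HasReturned, take_sampled, exists_prop]
  rfl

variable {I I'}

theorem hasReturned_congr (r : Ω) (J : Set ℝ) {m : ℕ} {X X' : Fin m → Fin n}
    (h : SameView I I' X X') : A.HasReturned I r J X ↔ A.HasReturned I' r J X' := by
  have hview (s : ℕ) (hs : s ≤ m) : I.view (Fin.take s hs X) = I'.view (Fin.take s hs X') :=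
    h.take hs
  simp only [HasReturned, hview]

theorem measure_returnsWithin_le (P : Measure Ω) [IsProbabilityMeasure P] {m : ℕ} {K η : ℝ}
    (hη : 0 ≤ η) (hK : K ≤ 1 + 4 * η ^ 2)
    (h : ∀ r, SecondMomentLE (SameView I I') (A.law I r m) (A.law I' r m) K)
    {J : Set ℝ} (hJ : MeasurableSet J) :
    (P.prod I'.supply) (A.returnsWithin I' m J) ≤
      (P.prod I.supply) (A.returnsWithin I m J) + ENNReal.ofReal η := by
  have hlaw (I : SumInstance n) (r : Ω) :
      I.supply (Prod.mk r ⁻¹' A.returnsWithin I m J) =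
        A.law I r m {X | A.HasReturned I r J X} := by
    rw [law, Measure.map_apply (A.measurable_sampled_right I r m) (Set.toFinite _).measurableSet]
    exact congrArg _ (Set.ext fun x => A.mem_returnsWithin_iff I r x m J)
  have hsection (r : Ω) : I'.supply (Prod.mk r ⁻¹' A.returnsWithin I' m J) ≤
      I.supply (Prod.mk r ⁻¹' A.returnsWithin I m J) + ENNReal.ofReal η := by
    have htv := (h r).four_mul_sq_measureReal_sub_le
      (D := {X | A.HasReturned I r J X}) (D' := {X' | A.HasReturned I' r J X'})
      (Set.toFinite _).measurableSet (Set.toFinite _).measurableSet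
      fun X X' => A.hasReturned_congr r J
    have hreal := (abs_le_of_sq_le_sq' (a := (A.law I' r m).real {X' | A.HasReturned I' r J X'} -
      (A.law I r m).real {X | A.HasReturned I r J X}) (by linarith) hη).2
    rw [hlaw, hlaw, ← ofReal_measureReal, ← ofReal_measureReal,
      ← ENNReal.ofReal_add measureReal_nonneg hη]
    exact ENNReal.ofReal_le_ofReal (sub_le_iff_le_add'.1 hreal)
  rw [Measure.prod_apply (A.measurableSet_returnsWithin I' m hJ),
    Measure.prod_apply (A.measurableSet_returnsWithin I m hJ)]
  refine (lintegral_mono hsection).trans ?_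
  rw [lintegral_add_right _ measurable_const, lintegral_const, measure_univ, mul_one]

theorem le_expectedSamples_of_secondMomentLE {m : ℕ} {K ε : ℝ} {P : Measure Ω}
    [IsProbabilityMeasure P] (hK : K ≤ 17 / 16)
    (h : ∀ r, SecondMomentLE (SameView I I') (A.law I r m) (A.law I' r m) K)
    (hsep : (1 + ε) * I.total < (1 - ε) * I'.total)
    (hs : 2 / 3 ≤ A.successProb I P ε) (hs' : 2 / 3 ≤ A.successProb I' P ε) :
    ((m + 1 : ℕ) : ℝ≥0∞) / 12 ≤ A.expectedSamples I P ∨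
      ((m + 1 : ℕ) : ℝ≥0∞) / 12 ≤ A.expectedSamples I' P := by
  by_contra! hfew
  set J := Set.Icc ((1 - ε) * I.total) ((1 + ε) * I.total)
  set J' := Set.Icc ((1 - ε) * I'.total) ((1 + ε) * I'.total)
  set p := (P.prod I.supply) (A.returnsWithin I m J)
  set p' := (P.prod I.supply) (A.returnsWithin I m J')
  have hp : 2 / 3 ≤ p + 12⁻¹ :=
    hs.trans (A.successProb_le_measure_returnsWithin_add I hfew.1.le)
  have hp' : 2 / 3 ≤ p' + ENNReal.ofReal (1 / 8) + 12⁻¹ :=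
    hs'.trans <| (A.successProb_le_measure_returnsWithin_add I' hfew.2.le).trans <| by
      gcongr
      exact A.measure_returnsWithin_le P (by norm_num) (by linarith) h measurableSet_Icc
  have hJ : Disjoint J J' :=
    Set.disjoint_left.2 fun y hy hy' => by linarith [hy.2, hy'.1]
  have hsum : p + p' ≤ 1 := by
    rw [← measure_union (A.disjoint_returnsWithin I m hJ)
      (A.measurableSet_returnsWithin I m measurableSet_Icc)]
    exact prob_le_one
  have htotal : (2 / 3 + 2 / 3 : ℝ≥0∞) ≤ 1 + (ENNReal.ofReal (1 / 8) + 12⁻¹ + 12⁻¹) :=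
    calc (2 / 3 + 2 / 3 : ℝ≥0∞)
      _ ≤ p + 12⁻¹ + (p' + ENNReal.ofReal (1 / 8) + 12⁻¹) := add_le_add hp hp'
      _ = p + p' + (ENNReal.ofReal (1 / 8) + 12⁻¹ + 12⁻¹) := by ring
      _ ≤ _ := by gcongr
  have hreal := ENNReal.toReal_mono (by finiteness) htotal
  rw [ENNReal.toReal_add (by finiteness) (by finiteness)] at hreal
  norm_num [ENNReal.toReal_add] at hreal

end ReturnEvents
end HybridAlgorithm

theorem add_sq_le_add_mul_add {x y a b c d : ℝ} (ha : 0 ≤ a) (hb : 0 ≤ b) (hc : 0 ≤ c)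
    (hd : 0 ≤ d) (hx : x ^ 2 ≤ a * c) (hy : y ^ 2 ≤ b * d) :
    (x + y) ^ 2 ≤ (a + b) * (c + d) := by
  have hcs := Finset.sum_sq_le_sum_mul_sum_of_sq_le_mul (Finset.univ : Finset (Fin 2))
    (r := ![x, y]) (f := ![a, b]) (g := ![c, d]) (by simp [Fin.forall_fin_two, ha, hb])
    (by simp [Fin.forall_fin_two, hc, hd]) (by simp [Fin.forall_fin_two, hx, hy])
  simpa using hcs

theorem sq_sum_le_card_sq_div_card_mul_sum {α β : Type*} {s : Finset α} {s' : Finset β}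
    (hs : s.Nonempty) {G : α → ℝ} {H : β → ℝ} (h : ∀ a ∈ s, ∀ b ∈ s', H b ^ 2 ≤ G a) :
    (∑ b ∈ s', H b) ^ 2 ≤ (s'.card : ℝ) ^ 2 / s.card * ∑ a ∈ s, G a := by
  have hpos : (0 : ℝ) < s.card := mod_cast hs.card_pos
  rw [div_mul_eq_mul_div, le_div_iff₀ hpos]
  calc (∑ b ∈ s', H b) ^ 2 * s.card
    _ ≤ (s'.card * ∑ b ∈ s', H b ^ 2) * s.card := by
        gcongr
        exact sq_sum_le_card_mul_sum_sq
    _ = s'.card * ∑ a ∈ s, ∑ b ∈ s', H b ^ 2 := by rw [Finset.sum_const, nsmul_eq_mul]; ring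
    _ ≤ s'.card * ∑ a ∈ s, ∑ _ ∈ s', G a := by gcongr with a ha b hb; exact h a ha b hb
    _ = s'.card ^ 2 * ∑ a ∈ s, G a := by
        simp only [Finset.sum_const, nsmul_eq_mul, ← Finset.mul_sum]; ring

theorem exists_injOn_image_eq_image {ι α β : Type*} [DecidableEq α] [DecidableEq β]
    (s : Finset ι) (f : ι → α) (g : ι → β) (h : ∀ i j, f i = f j ↔ g i = g j) :
    ∃ r : Finset ι, Set.InjOn f r ∧ Set.InjOn g r ∧ r.image f = s.image f ∧
      r.image g = s.image g := by
  obtain ⟨r, hrs, hr⟩ := (s : Set ι).exists_subset_bijOn f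
  lift r to Finset ι using s.finite_toSet.subset hrs
  have hsub : r ⊆ s := mod_cast hrs
  have himage : r.image f = s.image f := mod_cast hr.image_eq
  refine ⟨r, hr.injOn, fun i hi j hj hij => hr.injOn hi hj ((h i j).2 hij), himage,
    (Finset.image_subset_image hsub).antisymm fun b hb => ?_⟩
  obtain ⟨i, hi, rfl⟩ := Finset.mem_image.1 hb
  obtain ⟨j, hj, hji⟩ := Finset.mem_image.1 (himage ▸ Finset.mem_image_of_mem f hi)
  exact Finset.mem_image.2 ⟨j, hj, (h j i).1 hji⟩

theorem sq_sum_le_of_injOn {ι α β : Type*} [DecidableEq α] [DecidableEq β] {r : Finset ι}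
    {f : ι → α} {g : ι → β} (hf : Set.InjOn f r) (hg : Set.InjOn g r) {s : Finset α}
    {s' : Finset β} (hfs : r.image f ⊆ s) (hgs : r.image g ⊆ s') (hcard : r.card < s.card)
    {G : α → ℝ} {H : β → ℝ} (hG : ∀ a, 0 ≤ G a) (hr : ∀ i ∈ r, H (g i) ^ 2 ≤ G (f i))
    (h : ∀ a ∈ s \ r.image f, ∀ b ∈ s' \ r.image g, H b ^ 2 ≤ G a) :
    (∑ b ∈ s', H b) ^ 2 ≤
      (r.card + ((s'.card : ℝ) - r.card) ^ 2 / (s.card - r.card)) * ∑ a ∈ s, G a := by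
  have hfresh : ((s \ r.image f).card : ℝ) = s.card - r.card := by
    rw [Finset.cast_card_sdiff hfs, Finset.card_image_of_injOn hf]
  have hfresh' : ((s' \ r.image g).card : ℝ) = s'.card - r.card := by
    rw [Finset.cast_card_sdiff hgs, Finset.card_image_of_injOn hg]
  have hpos : (0 : ℝ) < s.card - r.card := sub_pos.2 (mod_cast hcard)
  have hnonempty : (s \ r.image f).Nonempty :=
    Finset.card_pos.1 (by exact_mod_cast hfresh ▸ hpos)
  rw [← Finset.sum_sdiff hfs, ← Finset.sum_sdiff hgs, Finset.sum_image hf, Finset.sum_image hg,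
    add_comm (r.card : ℝ), ← hfresh, ← hfresh']
  refine add_sq_le_add_mul_add (by positivity) (by positivity)
    (Finset.sum_nonneg fun a _ => hG a) (Finset.sum_nonneg fun i _ => hG _)
    (sq_sum_le_card_sq_div_card_mul_sum hnonempty h) (sq_sum_le_card_mul_sum_sq.trans ?_)
  gcongr with i hi
  exact hr i hi

theorem add_sq_sub_div_sub_eq {k c c' : ℝ} (h : k < c) :
    k + (c' - k) ^ 2 / (c - k) = 2 * c' - c + (c' - c) ^ 2 / (c - k) := by
  have : c - k ≠ 0 := (sub_pos.2 h).ne'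
  field_simp
  ring

namespace SumInstance

variable {n : ℕ}

/-- The items of weight `τ`. -/
noncomputable def weightClass (I : SumInstance n) (τ : ℝ≥0) : Finset (Fin n) := {a | I.w a = τ}

theorem mem_weightClass {I : SumInstance n} {τ : ℝ≥0} {a : Fin n} :
    a ∈ I.weightClass τ ↔ I.w a = τ := by
  simp [weightClass]

theorem sq_sum_weightClass_le {I I' : SumInstance n} {t : ℕ} {X X' : Fin t → Fin n}
    (hX : SameView I I' X X') {G H : Fin n → ℝ} (hG : ∀ a, 0 ≤ G a)
    (hGH : ∀ a a', SameExtension I I' X X' a a' → H a' ^ 2 ≤ G a) {τ : ℝ≥0}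
    (ht : t < (I.weightClass τ).card) :
    (∑ a ∈ I'.weightClass τ, H a) ^ 2 ≤
      (t + ((I'.weightClass τ).card - t : ℝ) ^ 2 / ((I.weightClass τ).card - t)) *
        ∑ a ∈ I.weightClass τ, G a := by
  obtain ⟨hweight, hpattern⟩ := sameView_iff.1 hX
  obtain ⟨r, hinj, hinj', himage, himage'⟩ :=
    exists_injOn_image_eq_image {i | I.w (X i) = τ} X X' hpattern
  have hmem (a : Fin n) : a ∈ r.image X ↔ I.w a = τ ∧ ∃ i, X i = a := by
    rw [himage]; aesop
  have hmem' (a : Fin n) : a ∈ r.image X' ↔ I'.w a = τ ∧ ∃ i, X' i = a := by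
    rw [himage']; aesop
  have hcard : r.card ≤ t := by simpa using r.card_le_univ
  have hclass := sq_sum_le_of_injOn hinj hinj' (s := I.weightClass τ) (s' := I'.weightClass τ)
    (fun a ha => mem_weightClass.2 ((hmem a).1 ha).1)
    (fun a ha => mem_weightClass.2 ((hmem' a).1 ha).1) (hcard.trans_lt ht) hG
    (fun i _ => hGH _ _ ((sameExtension_iff hX).2 ⟨hweight i, fun j => hpattern j i⟩))
    fun a ha a' ha' => by
      simp only [Finset.mem_sdiff, mem_weightClass, hmem, hmem', not_and, not_exists] at ha ha'
      exact hGH a a' ((sameExtension_iff hX).2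
        ⟨ha.1.trans ha'.1.symm, fun i => iff_of_false (ha.2 ha.1 i) (ha'.2 ha'.1 i)⟩)
  -- The more distinct items of weight `τ` have been seen, the larger the bound: `r.card` may be
  -- replaced by `t`.
  refine hclass.trans (mul_le_mul_of_nonneg_right ?_ (Finset.sum_nonneg fun a _ => hG a))
  have ht' : (t : ℝ) < (I.weightClass τ).card := mod_cast ht
  have hcard' : (r.card : ℝ) ≤ t := mod_cast hcard
  rw [add_sq_sub_div_sub_eq ht', add_sq_sub_div_sub_eq (hcard'.trans_lt ht')]
  gcongr

/-- The instance with `s` items of weight `1` and `n - s` items of weight `0`. -/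
noncomputable def zeroOne (n s : ℕ) (hs : 0 < s) (hsn : s ≤ n) : SumInstance n where
  w a := if (a : ℕ) < s then 1 else 0
  sum_pos := Finset.sum_pos' (fun _ _ => zero_le)
    ⟨⟨0, hs.trans_le hsn⟩, Finset.mem_univ _, by simp [hs]⟩

variable {s : ℕ} (hs : 0 < s) (hsn : s ≤ n)

theorem weightClass_zeroOne_zero :
    (zeroOne n s hs hsn).weightClass 0 = ((zeroOne n s hs hsn).weightClass 1)ᶜ := by
  ext a
  simp [mem_weightClass, zeroOne]

theorem card_weightClass_zeroOne_one : ((zeroOne n s hs hsn).weightClass 1).card = s := by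
  simp [weightClass, zeroOne, Fin.card_filter_val_lt, hsn]

theorem card_weightClass_zeroOne_zero : ((zeroOne n s hs hsn).weightClass 0).card = n - s := by
  rw [weightClass_zeroOne_zero, Finset.card_compl, card_weightClass_zeroOne_one, Fintype.card_fin]

theorem sum_weightClass_zeroOne (f : Fin n → ℝ) :
    ∑ a ∈ (zeroOne n s hs hsn).weightClass 1, f a + ∑ a ∈ (zeroOne n s hs hsn).weightClass 0, f a =
      ∑ a, f a := by
  rw [weightClass_zeroOne_zero, Finset.sum_add_sum_compl]

theorem sum_w_mul_zeroOne (f : Fin n → ℝ) :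
    ∑ a, (zeroOne n s hs hsn).w a * f a = ∑ a ∈ (zeroOne n s hs hsn).weightClass 1, f a := by
  simp [weightClass, Finset.sum_filter, zeroOne, apply_ite, ite_mul]

theorem total_zeroOne : (zeroOne n s hs hsn).total = s := by
  simpa [total, card_weightClass_zeroOne_one] using sum_w_mul_zeroOne hs hsn fun _ => 1

/-- A bound for the excess over `1` of the second moment of the likelihood ratio, when one of the
first `m` samples tells apart the instances with `s` and with `s + d` unit items. The two terms
account for proportional and for uniform samples. -/
noncomputable def zeroOneExcess (n s d m : ℝ) : ℝ := 2 * m * d ^ 2 / s ^ 3 + 4 * d ^ 2 / (s * n)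

section OneStep

variable {d m t : ℕ} (hs' : 0 < s + d) (hsn' : s + d ≤ n) {X X' : Fin t → Fin n}

theorem secondMomentLE_proportional (hts : t < s)
    (hX : SameView (zeroOne n s hs hsn) (zeroOne n (s + d) hs' hsn') X X') :
    SecondMomentLE (SameExtension (zeroOne n s hs hsn) (zeroOne n (s + d) hs' hsn') X X')
      ((zeroOne n s hs hsn).sampleLaw .proportional)
      ((zeroOne n (s + d) hs' hsn').sampleLaw .proportional)
      (1 + t * d ^ 2 / ((s - t) * (s + d) ^ 2)) := by
  intro G H hG hGH
  have hone := sq_sum_weightClass_le hX hG hGH (τ := 1) (by rwa [card_weightClass_zeroOne_one])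
  rw [integral_sampleLaw_proportional, integral_sampleLaw_proportional, sum_w_mul_zeroOne,
    sum_w_mul_zeroOne, total_zeroOne, total_zeroOne, div_pow, div_le_iff₀ (by positivity)]
  refine hone.trans_eq ?_
  rw [card_weightClass_zeroOne_one, card_weightClass_zeroOne_one]
  have hs0 : (s : ℝ) ≠ 0 := by positivity
  have hst : (s - t : ℝ) ≠ 0 := (sub_pos.2 (mod_cast hts)).ne'
  have hsd : (s + d : ℝ) ≠ 0 := by positivity
  push_cast
  field_simp
  ring

theorem secondMomentLE_uniform (hts : t < s) (htn : t < n - s)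
    (hX : SameView (zeroOne n s hs hsn) (zeroOne n (s + d) hs' hsn') X X') :
    SecondMomentLE (SameExtension (zeroOne n s hs hsn) (zeroOne n (s + d) hs' hsn') X X')
      ((zeroOne n s hs hsn).sampleLaw .uniform)
      ((zeroOne n (s + d) hs' hsn').sampleLaw .uniform)
      (1 + d ^ 2 * (1 / (s - t) + 1 / (n - s - t)) / n) := by
  intro G H hG hGH
  have hone := sq_sum_weightClass_le hX hG hGH (τ := 1) (by rwa [card_weightClass_zeroOne_one])
  have hzero := sq_sum_weightClass_le hX hG hGH (τ := 0) (by rwa [card_weightClass_zeroOne_zero])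
  rw [card_weightClass_zeroOne_one, card_weightClass_zeroOne_one] at hone
  rw [card_weightClass_zeroOne_zero, card_weightClass_zeroOne_zero, Nat.cast_sub hsn,
    Nat.cast_sub hsn'] at hzero
  have hst : (0 : ℝ) < s - t := sub_pos.2 (mod_cast hts)
  have hnst : (0 : ℝ) < n - s - t := by
    rw [← Nat.cast_sub hsn]
    exact sub_pos.2 (mod_cast htn)
  have hn : (0 : ℝ) < n := mod_cast hs.trans_le hsn
  rw [integral_sampleLaw_uniform, integral_sampleLaw_uniform,
    ← sum_weightClass_zeroOne hs' hsn' H, ← sum_weightClass_zeroOne hs hsn G, div_pow,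
    div_le_iff₀ (by positivity)]
  refine (add_sq_le_add_mul_add (by positivity) (by positivity)
    (Finset.sum_nonneg fun a _ => hG a) (Finset.sum_nonneg fun a _ => hG a) hone hzero).trans_eq ?_
  push_cast
  field_simp
  ring

theorem secondMomentLE_sampleLaw_zeroOne (htm : t ≤ m) (hms : 2 * m ≤ s) (hn : 2 * (s + d) ≤ n)
    (hX : SameView (zeroOne n s hs hsn) (zeroOne n (s + d) hs' hsn') X X') (k : SampleKind) :
    SecondMomentLE (SameExtension (zeroOne n s hs hsn) (zeroOne n (s + d) hs' hsn') X X')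
      ((zeroOne n s hs hsn).sampleLaw k) ((zeroOne n (s + d) hs' hsn').sampleLaw k)
      (1 + zeroOneExcess n s d m) := by
  have hs0 : (0 : ℝ) < s := mod_cast hs
  have hn0 : (0 : ℝ) < n := mod_cast hs.trans_le hsn
  have htm' : (t : ℝ) ≤ m := mod_cast htm
  have hms' : (2 * m : ℝ) ≤ s := mod_cast hms
  have hn' : (2 * (s + d) : ℝ) ≤ n := mod_cast hn
  have hst : (s / 2 : ℝ) ≤ s - t := by linarith
  have hnst : (s / 2 : ℝ) ≤ n - s - t := by linarith
  cases k
  · refine (secondMomentLE_proportional hs hsn hs' hsn' (by omega) hX).mono ?_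
    have hcollision : (t * d ^ 2 / ((s - t) * (s + d) ^ 2) : ℝ) ≤ m * d ^ 2 / (s / 2 * s ^ 2) := by
      gcongr <;> linarith
    have heq : (m * d ^ 2 / (s / 2 * s ^ 2) : ℝ) = 2 * m * d ^ 2 / s ^ 3 := by field_simp
    have hnonneg : (0 : ℝ) ≤ 4 * d ^ 2 / (s * n) := by positivity
    rw [zeroOneExcess]
    linarith
  · refine (secondMomentLE_uniform hs hsn hs' hsn' (by omega) (by omega) hX).mono ?_
    have hweight : (d ^ 2 * (1 / (s - t) + 1 / (n - s - t)) / n : ℝ) ≤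
        d ^ 2 * (1 / (s / 2) + 1 / (s / 2)) / n := by
      gcongr
    have heq : (d ^ 2 * (1 / (s / 2) + 1 / (s / 2)) / n : ℝ) = 4 * d ^ 2 / (s * n) := by
      field_simp
      ring
    have hnonneg : (0 : ℝ) ≤ 2 * m * d ^ 2 / s ^ 3 := by positivity
    rw [zeroOneExcess]
    linarith

end OneStep

end SumInstance

namespace SumInstance

theorem mul_zeroOneExcess_le {κ γ L ε n s d m : ℝ} (hL : 0 < L) (hε : 0 < ε)
    (hn : L ^ 3 * ε ^ 4 = n) (hs : L ^ 2 * ε ^ 2 ≤ s) (hs' : s ≤ 2 * (L ^ 2 * ε ^ 2))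
    (hd : 0 ≤ d) (hd' : d ≤ 4 * κ * (ε * s)) (hm : 0 ≤ m) (hm' : m ≤ γ * L) :
    m * zeroOneExcess n s d m ≤ 32 * κ ^ 2 * γ ^ 2 + 128 * κ ^ 2 * γ := by
  have hγ : 0 ≤ γ := nonneg_of_mul_nonneg_left (hm.trans hm') hL
  have hs0 : 0 < s := lt_of_lt_of_le (by positivity) hs
  have hn0 : 0 < n := hn ▸ by positivity
  have hcollision : 2 * m ^ 2 * d ^ 2 / s ^ 3 ≤ 32 * κ ^ 2 * γ ^ 2 :=
    calc 2 * m ^ 2 * d ^ 2 / s ^ 3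
      _ ≤ 2 * (γ * L) ^ 2 * (4 * κ * (ε * s)) ^ 2 / s ^ 3 := by gcongr
      _ = 32 * κ ^ 2 * γ ^ 2 * (L ^ 2 * ε ^ 2) / s := by field_simp; ring
      _ ≤ 32 * κ ^ 2 * γ ^ 2 * s / s := by gcongr
      _ = 32 * κ ^ 2 * γ ^ 2 := mul_div_cancel_right₀ _ hs0.ne'
  have hweight : 4 * m * d ^ 2 / (s * n) ≤ 128 * κ ^ 2 * γ :=
    calc 4 * m * d ^ 2 / (s * n)
      _ ≤ 4 * (γ * L) * (4 * κ * (ε * s)) ^ 2 / (s * n) := by gcongr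
      _ = 64 * κ ^ 2 * γ * (L * ε ^ 2 * s) / n := by field_simp; ring
      _ ≤ 64 * κ ^ 2 * γ * (L * ε ^ 2 * (2 * (L ^ 2 * ε ^ 2))) / n := by gcongr
      _ = 128 * κ ^ 2 * γ := by rw [← hn]; field_simp; ring
  calc m * zeroOneExcess n s d m
    _ = 2 * m ^ 2 * d ^ 2 / s ^ 3 + 4 * m * d ^ 2 / (s * n) := by rw [zeroOneExcess]; ring
    _ ≤ _ := add_le_add hcollision hweight

theorem exists_zeroOne_parameters {κ L ε : ℝ} {n m : ℕ} (hκ : 1 ≤ κ) (hε : 0 < ε)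
    (hκε : 1 ≤ κ * (1 - ε)) (hn : L ^ 3 * ε ^ 4 = n) (hlarge : 20 * κ ≤ L * ε ^ 2)
    (hm : m ≤ L / (4096 * κ ^ 2)) :
    ∃ s d : ℕ, 0 < s ∧ 2 * m ≤ s ∧ 2 * (s + d) ≤ n ∧ (1 + ε) * s < (1 - ε) * (s + d : ℕ) ∧
      m * zeroOneExcess n s d m ≤ 1 / 17 := by
  have hε1 : ε ≤ 1 := by nlinarith
  have hL : 0 < L := pos_of_mul_pos_left (by linarith) (sq_nonneg ε)
  have hL1 : 20 * κ ≤ L * ε := hlarge.trans (by nlinarith [mul_pos hL hε])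
  obtain ⟨s, hs, hs'⟩ : ∃ s : ℕ, L ^ 2 * ε ^ 2 ≤ s ∧ (s : ℝ) ≤ 2 * (L ^ 2 * ε ^ 2) := by
    have hσ : 1 ≤ L ^ 2 * ε ^ 2 := by nlinarith
    exact ⟨_, Nat.le_ceil _, by linarith [Nat.ceil_lt_add_one (zero_le_one.trans hσ)]⟩
  have hεs : 1 ≤ ε * s := by
    have : 1 ≤ (L * ε) * (L * ε ^ 2) := one_le_mul_of_one_le_of_one_le (by linarith) (by linarith)
    nlinarith
  obtain ⟨d, hd, hd'⟩ : ∃ d : ℕ, 3 * κ * (ε * s) ≤ d ∧ (d : ℝ) ≤ 4 * κ * (ε * s) := by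
    refine ⟨_, Nat.le_ceil _, ?_⟩
    have := Nat.ceil_lt_add_one (show 0 ≤ 3 * κ * (ε * s) by positivity)
    nlinarith
  have hms : (2 * m : ℝ) ≤ s :=
    calc (2 * m : ℝ)
      _ ≤ 2 * (L / 2) := by gcongr; exact hm.trans (by gcongr; nlinarith)
      _ ≤ L * (L * ε ^ 2) := by nlinarith
      _ ≤ s := by linarith
  have hsdn : (2 * (s + d) : ℝ) ≤ n :=
    calc (2 * (s + d) : ℝ)
      _ ≤ 2 * (κ * s + 4 * κ * (1 * s)) := by
          gcongr
          · nlinarith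
          · exact hd'.trans (by gcongr)
      _ = 10 * κ * s := by ring
      _ ≤ 10 * κ * (2 * (L ^ 2 * ε ^ 2)) := by gcongr
      _ = 20 * κ * (L ^ 2 * ε ^ 2) := by ring
      _ ≤ L * ε ^ 2 * (L ^ 2 * ε ^ 2) := by gcongr
      _ = n := by rw [← hn]; ring
  have hsep : 3 * (ε * s) ≤ (1 - ε) * d :=
    calc 3 * (ε * s)
      _ ≤ κ * (1 - ε) * (3 * (ε * s)) := le_mul_of_one_le_left (by positivity) hκε
      _ = (1 - ε) * (3 * κ * (ε * s)) := by ring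
      _ ≤ (1 - ε) * d := mul_le_mul_of_nonneg_left hd (sub_nonneg.2 hε1)
  refine ⟨s, d, ?_, mod_cast hms, mod_cast hsdn, by push_cast; linarith, ?_⟩
  · exact Nat.pos_of_ne_zero fun h => by norm_num [h] at hεs
  · have hκγ : κ ^ 2 * (4096 * κ ^ 2)⁻¹ = 1 / 4096 := by field_simp
    have hγ : (4096 * κ ^ 2)⁻¹ ≤ 1 := inv_le_one_of_one_le₀ (by nlinarith)
    refine (mul_zeroOneExcess_le hL hε hn hs hs' d.cast_nonneg hd' m.cast_nonneg
      (hm.trans_eq (div_eq_inv_mul _ _))).trans ?_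
    linear_combination (32 * (4096 * κ ^ 2)⁻¹ + 128) * hκγ + 1 / 128 * hγ

end SumInstance

namespace HybridAlgorithm

open SumInstance

variable {Ω : Type*} [MeasurableSpace Ω] (A : HybridAlgorithm Ω) {n : ℕ} {P : Measure Ω}
  [IsProbabilityMeasure P] {κ L ε : ℝ}

theorem secondMomentLE_law_zeroOne {s d m : ℕ} (hs : 0 < s) (hsn : s ≤ n) (hs' : 0 < s + d)
    (hsn' : s + d ≤ n) (hms : 2 * m ≤ s) (hn : 2 * (s + d) ≤ n)
    (hexcess : m * zeroOneExcess n s d m ≤ 1 / 17) (r : Ω) :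
    SecondMomentLE (SameView (zeroOne n s hs hsn) (zeroOne n (s + d) hs' hsn'))
      (A.law (zeroOne n s hs hsn) r m) (A.law (zeroOne n (s + d) hs' hsn') r m) (17 / 16) := by
  have hnonneg : 0 ≤ zeroOneExcess n s d m := by unfold zeroOneExcess; positivity
  refine (A.secondMomentLE_law r (by positivity) fun t ht X X' hX k =>
    secondMomentLE_sampleLaw_zeroOne hs hsn hs' hsn' ht.le hms hn hX k).mono ?_
  calc (1 + zeroOneExcess n s d m) ^ m
    _ ≤ Real.exp (zeroOneExcess n s d m) ^ m := by
        gcongr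
        linarith [Real.add_one_le_exp (zeroOneExcess n s d m)]
    _ = Real.exp (m * zeroOneExcess n s d m) := (Real.exp_nat_mul _ m).symm
    _ ≤ Real.exp (1 / 17) := Real.exp_le_exp.2 hexcess
    _ ≤ 1 / (1 - 1 / 17) := Real.exp_bound_div_one_sub_of_interval (by norm_num) (by norm_num)
    _ = 17 / 16 := by norm_num

theorem exists_le_expectedSamples_of_le_mul_sq (hκ : 1 ≤ κ) (hε : 0 < ε) (hκε : 1 ≤ κ * (1 - ε))
    (hn : L ^ 3 * ε ^ 4 = n) (hlarge : 20 * κ ≤ L * ε ^ 2)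
    (hA : ∀ I : SumInstance n, 2 / 3 ≤ A.successProb I P ε) :
    ∃ I : SumInstance n,
      ENNReal.ofReal (L / (49152 * κ ^ 2)) ≤ A.expectedSamples I P := by
  have hL : 0 < L := pos_of_mul_pos_left (by linarith) (sq_nonneg ε)
  obtain ⟨m, hm, hm'⟩ : ∃ m : ℕ, m ≤ L / (4096 * κ ^ 2) ∧ L / (4096 * κ ^ 2) < m + 1 :=
    ⟨⌊L / (4096 * κ ^ 2)⌋₊, Nat.floor_le (by positivity), Nat.lt_floor_add_one _⟩
  obtain ⟨s, d, hs, hms, hsdn, hsep, hexcess⟩ :=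
    exists_zeroOne_parameters hκ hε hκε hn hlarge hm
  have hbound : ENNReal.ofReal (L / (49152 * κ ^ 2)) ≤ ((m + 1 : ℕ) : ℝ≥0∞) / 12 :=
    calc ENNReal.ofReal (L / (49152 * κ ^ 2))
      _ = ENNReal.ofReal (L / (4096 * κ ^ 2) / 12) := by
          rw [div_div, mul_right_comm]; norm_num
      _ ≤ ENNReal.ofReal ((m + 1 : ℕ) / 12) := by push_cast; gcongr
      _ = ((m + 1 : ℕ) : ℝ≥0∞) / 12 := by
          rw [ENNReal.ofReal_div_of_pos (by norm_num), ENNReal.ofReal_natCast, ENNReal.ofReal_ofNat]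
  rcases A.le_expectedSamples_of_secondMomentLE le_rfl
    (A.secondMomentLE_law_zeroOne hs (by omega) (by omega) (by omega) hms hsdn hexcess)
    (by rwa [total_zeroOne, total_zeroOne]) (hA _) (hA _) with h | h
  · exact ⟨_, hbound.trans h⟩
  · exact ⟨_, hbound.trans h⟩

theorem exists_one_twelfth_le_expectedSamples (hn : 1 ≤ n) (hε : ε < 1)
    (hA : ∀ I : SumInstance n, 2 / 3 ≤ A.successProb I P ε) :
    ∃ I : SumInstance n, 1 / 12 ≤ A.expectedSamples I P := by
  obtain ⟨k, hk⟩ := exists_nat_gt ((1 + ε) / (1 - ε))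
  have hn0 : (0 : ℝ) < n := mod_cast hn
  let const (w : ℕ) : SumInstance n :=
    ⟨fun _ => w + 1, Finset.sum_pos (fun _ _ => by positivity) ⟨⟨0, hn⟩, Finset.mem_univ _⟩⟩
  have htotal (w : ℕ) : (const w).total = n * (w + 1) := by
    simp [total, const, mul_add_one]
  have hsep : (1 + ε) * (const 0).total < (1 - ε) * (const k).total := by
    rw [div_lt_iff₀ (by linarith)] at hk
    rw [htotal, htotal, Nat.cast_zero]
    nlinarith
  rcases A.le_expectedSamples_of_secondMomentLE (by norm_num) A.secondMomentLE_law_zero hsep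
    (hA _) (hA _) with h | h
  · exact ⟨_, by simpa using h⟩
  · exact ⟨_, by simpa using h⟩

theorem exists_le_expectedSamples_of_mul_sq_lt (hκ : 2 ≤ κ) (hε : 0 < ε) (hn : L ^ 3 * ε ^ 4 = n)
    (hn' : 4 * (20 * κ) ^ 3 < n) (hsmall : L * ε ^ 2 < 20 * κ)
    (hA : ∀ I : SumInstance n, 2 / 3 ≤ A.successProb I P ε) :
    ∃ I : SumInstance n,
      ENNReal.ofReal (n / (49152 * κ ^ 2 * (20 * κ) ^ 2)) ≤ A.expectedSamples I P := by
  set b := 20 * κ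
  have hb : 0 < b := by positivity
  have hn0 : (0 : ℝ) < n := lt_of_le_of_lt (by positivity) hn'
  have hL : 0 < L :=
    (Odd.pow_pos_iff (by decide)).1 (pos_of_mul_pos_left (hn ▸ hn0) (by positivity))
  -- At accuracy `ε'` the quantity `L ε ^ 2` takes the value `b`, with `n / b ^ 2` in place of `L`.
  set ε' := √(b ^ 3 / n)
  have hε'_sq : ε' ^ 2 = b ^ 3 / n := Real.sq_sqrt (by positivity)
  have hε' : 0 < ε' := Real.sqrt_pos.2 (by positivity)
  have hε'_le : ε' ≤ 1 / 2 := by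
    refine Real.sqrt_le_iff.2 ⟨by norm_num, ?_⟩
    rw [div_le_iff₀ hn0]
    linarith
  have hεε' : ε ≤ ε' := by
    refine Real.le_sqrt_of_sq_le ?_
    rw [le_div_iff₀ hn0]
    calc ε ^ 2 * n = (L * ε ^ 2) ^ 3 := by rw [← hn]; ring
      _ ≤ b ^ 3 := by gcongr
  have hn_eq : (n / b ^ 2) ^ 3 * ε' ^ 4 = n := by
    rw [show ε' ^ 4 = (ε' ^ 2) ^ 2 by ring, hε'_sq]
    field_simp
  have hlarge : b ≤ n / b ^ 2 * ε' ^ 2 := by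
    rw [hε'_sq]
    exact le_of_eq (by field_simp)
  obtain ⟨I, hI⟩ := A.exists_le_expectedSamples_of_le_mul_sq (by linarith) hε' (by nlinarith) hn_eq
    hlarge fun I => (hA I).trans (A.successProb_mono I P hεε')
  exact ⟨I, by rwa [div_div, mul_comm (b ^ 2)] at hI⟩

theorem exists_le_expectedSamples (hκ : 2 ≤ κ) (hε : 0 < ε) (hκε : 1 ≤ κ * (1 - ε)) (hn1 : 1 ≤ n)
    (hn : L ^ 3 * ε ^ 4 = n) (hA : ∀ I : SumInstance n, 2 / 3 ≤ A.successProb I P ε) :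
    ∃ I : SumInstance n,
      ENNReal.ofReal (min L n / (49152 * κ ^ 2 * (20 * κ) ^ 2)) ≤ A.expectedSamples I P := by
  rcases le_or_gt (n : ℝ) (4 * (20 * κ) ^ 3) with hn' | hn'
  · obtain ⟨I, hI⟩ := A.exists_one_twelfth_le_expectedSamples hn1 (by nlinarith) hA
    have hsmall : min L n / (49152 * κ ^ 2 * (20 * κ) ^ 2) ≤ 1 / 12 :=
      calc min L n / (49152 * κ ^ 2 * (20 * κ) ^ 2)
        _ ≤ 4 * (20 * κ) ^ 3 / (49152 * κ ^ 2 * (20 * κ) ^ 2) := by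
            gcongr
            exact (min_le_right _ _).trans hn'
        _ = 80 / 49152 / κ := by field_simp; norm_num
        _ ≤ 80 / 49152 / 2 := by gcongr
        _ ≤ 1 / 12 := by norm_num
    refine ⟨I, (ENNReal.ofReal_le_ofReal hsmall).trans (le_of_eq_of_le ?_ hI)⟩
    rw [ENNReal.ofReal_div_of_pos (by norm_num), ENNReal.ofReal_one, ENNReal.ofReal_ofNat]
  rcases le_or_gt (20 * κ) (L * ε ^ 2) with hlarge | hsmall
  · obtain ⟨I, hI⟩ := A.exists_le_expectedSamples_of_le_mul_sq (by linarith) hε hκε hn hlarge hA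
    have hL : 0 < L := pos_of_mul_pos_left (by linarith) (sq_nonneg ε)
    refine ⟨I, le_trans (ENNReal.ofReal_le_ofReal ?_) hI⟩
    refine div_le_div₀ hL.le (min_le_left _ _) (by positivity) ?_
    exact le_mul_of_one_le_right (by positivity) (one_le_pow₀ (by linarith))
  · obtain ⟨I, hI⟩ := A.exists_le_expectedSamples_of_mul_sq_lt hκ hε hn hn' hsmall hA
    exact ⟨I, le_trans (ENNReal.ofReal_le_ofReal (by gcongr; exact min_le_right _ _)) hI⟩

end HybridAlgorithm

theorem pow_three_mul_pow_four_of_rpow {x ε : ℝ} (hx : 0 ≤ x) (hε : 0 < ε) :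
    (x ^ (1 / 3 : ℝ) / ε ^ (4 / 3 : ℝ)) ^ 3 * ε ^ 4 = x := by
  rw [div_pow, ← Real.rpow_mul_natCast hx, ← Real.rpow_mul_natCast hε.le]
  norm_num
  field_simp

/-- Lower bound for sum estimation in the hybrid setting with `n` known. The constant `c` depends
only on the bound `ε₀ < 1` on the accuracy; the algorithm may depend on `n` and `ε`, and has to be
correct only on instances with exactly `n` items. -/
theorem mainTheorem8 (ε₀ : ℝ) (hε₀ : ε₀ < 1) :
    ∃ c : ℝ, 0 < c ∧
      ∀ (n : ℕ) (_ : 1 ≤ n) (ε : ℝ) (_ : 0 < ε) (_ : ε ≤ ε₀)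
        (Ω : Type*) [MeasurableSpace Ω] (P : Measure Ω) [IsProbabilityMeasure P]
        (A : HybridAlgorithm Ω),
        (∀ I : SumInstance n, 2 / 3 ≤ A.successProb I P ε) →
          ∃ I : SumInstance n,
            ENNReal.ofReal
                (c * min ((n : ℝ) ^ (1 / 3 : ℝ) / ε ^ (4 / 3 : ℝ)) (n : ℝ)) ≤
              A.expectedSamples I P := by
  set κ := max 2 (1 - ε₀)⁻¹
  have hκ : 2 ≤ κ := le_max_left _ _
  refine ⟨(49152 * κ ^ 2 * (20 * κ) ^ 2)⁻¹, by positivity, fun n hn ε hε hεε₀ Ω _ P _ A hA => ?_⟩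
  have hκε : 1 ≤ κ * (1 - ε) :=
    calc 1 = (1 - ε₀)⁻¹ * (1 - ε₀) := (inv_mul_cancel₀ (sub_pos.2 hε₀).ne').symm
      _ ≤ κ * (1 - ε) := by
        gcongr
        exact le_max_right _ _
  rw [← div_eq_inv_mul]
  exact A.exists_le_expectedSamples hκ hε hκε hn
    (pow_three_mul_pow_four_of_rpow n.cast_nonneg hε) hA
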